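/- Let $d\ge 1$, let $\mathbb V=\{e\in\mathbb Z^d:|e|_1=1\}$, and let $\mathcal P_{\mathbb V}$ be the set of probability vectors $p=(p(e))_{e\in\mathbb V}$. For an environment $\omega:\mathbb Z^d\to\mathcal P_{\mathbb V}$, let $P_{0,\omega}$ be the law of the Markov chain $(X_n)_{n\ge 0}$ on $\mathbb Z^d$ with $X_0=0$ which jumps from $y$ to $y+e$ with probability $\omega(y)(e)$. Given $u\in\mathbb Q^d$, real numbers $0=r_0<r_1<\dots<r_j$ and $\sigma_1,\dots,\sigma_j\in\mathcal P_{\mathbb V}$, the $(u;r_1,\dots,r_j)$-strip periodic environment generated by $\sigma_1,\dots,\sigma_j$ is the environment $\omega$ with $\omega(x)=\sigma_l$ whenever $k r_j+r_{l-1}\le\langle x,u\rangle<k r_j+r_l$ for some $k\in\mathbb Z$ and $1\le l\le j$. Given $\mathbf n=(n_1,\dots,n_d)$ with positive integer entries, $\mathbf B_{\mathbf n}=\{x\in\mathbb Z^d:0\le x_i\le n_i-1 \text{ for all } i\}$ and $\mathbf p:\mathbf B_{\mathbf n}\to\mathcal P_{\mathbb V}$, the periodic environment $\omega_{\mathbf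 n,\mathbf p}$ is $\omega_{\mathbf n,\mathbf p}(x)=\mathbf p(x \bmod \mathbf n)$, with the residue taken coordinatewise. **Lemma.** Let $\kappa>0$, $j\ge 1$, and let $\sigma_1,\dots,\sigma_j\in\mathcal P_{\mathbb V}$ be distinct with $\sigma_i(e)\ge\kappa$ for all $i$ and all $e\in\mathbb V$. Assume that $u\in\mathbb Q^d$ satisfies $|u|_2=1$ and $\big\langle \sum_{e\in\mathbb V}\sigma_i(e)e,\,u\big\rangle=0$ for all $1\le i\le j$. Then for every $\varepsilon>0$ and every $(\lambda_1,\dots,\lambda_j)\in[0,\infty)^j$ with $\sum_m\lambda_m=1$ there are $\mathbf n$ and $\mathbf p:\mathbf B_{\mathbf n}\to\{\sigma_1,\dots,\sigma_j\}$ such that $\omega_{\mathbf n,\mathbf p}$ is, for some $0<r_1<\dots<r_j$, the $(u;r_1,\dots,r_j)$-strip periodic environment generated by $\sigma_1,\dots,\sigma_j$, and such that $P_{0,\omega_{\mathbf n,\mathbf p}}$-almost surely, for every $1\le m\le j$, $$\limsup_{n\to\infty}\left|\frac1n\sum_{i=0}^n 1_{\{X_i\in S_m\}}-\lambda_m\right|\le\varepsilon,\qquad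 S_m:=\{x\in\mathbb Z^d:\omega_{\mathbf n,\mathbf p}(x)=\sigma_m\}.$$ -/

import Mathlib

namespace StripWalk

open MeasureTheory ProbabilityTheory

/-- The set `𝕍` of unit vectors of `ℤ^d`, i.e. of `e ∈ ℤ^d` with `|e|₁ = 1`. -/
abbrev UnitVec (d : ℕ) : Type := {e : Fin d → ℤ // ∑ i, |e i| = 1}

instance instFiniteUnitVec (d : ℕ) : Finite (UnitVec d) := by
  have h : ∀ e : UnitVec d, e.1 ∈ Set.Icc (fun _ : Fin d => (-1 : ℤ)) (fun _ => 1) := by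
    intro e
    have hi : ∀ i, |e.1 i| ≤ 1 := fun i =>
      (Finset.single_le_sum (f := fun i => |e.1 i|) (fun k _ => abs_nonneg _)
        (Finset.mem_univ i)).trans e.2.le
    exact ⟨fun i => (abs_le.1 (hi i)).1, fun i => (abs_le.1 (hi i)).2⟩
  exact ((Set.finite_Icc _ _).subset (fun e he => h ⟨e, he⟩)).to_subtype

noncomputable instance instFintypeUnitVec (d : ℕ) : Fintype (UnitVec d) := Fintype.ofFinite _

/-- The simplex `𝒫_𝕍` of probability vectors on `𝕍` (jump laws). -/
abbrev JumpLaw (d : ℕ) : Type := stdSimplex ℝ (UnitVec d)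

/-- The set `𝒫_𝕍^{(κ)}` of probability vectors on `𝕍` all of whose entries are at least `κ`. -/
def ellipticLaws (d : ℕ) (κ : ℝ) : Set (JumpLaw d) := {p | ∀ e : UnitVec d, κ ≤ p.1 e}

/-- The drift `∑ₑ p(e) e ∈ ℝ^d` of a jump law `p`. -/
noncomputable def drift {d : ℕ} (p : JumpLaw d) : Fin d → ℝ :=
  fun i => ∑ e : UnitVec d, p.1 e * (e.1 i : ℝ)

/-- An environment on `ℤ^d`: a jump law at every site. -/
abbrev Environment (d : ℕ) : Type := (Fin d → ℤ) → JumpLaw d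

/-- The one-step law from the site `y`: jump to `y + e` with probability `ω(y, e)`. -/
noncomputable def stepLaw {d : ℕ} (ω : Environment d) (y : Fin d → ℤ) : Measure (Fin d → ℤ) :=
  ∑ e : UnitVec d, ENNReal.ofReal ((ω y).1 e) • Measure.dirac (y + e.1)

instance instIsProbabilityMeasureStepLaw {d : ℕ} (ω : Environment d) (y : Fin d → ℤ) :
    IsProbabilityMeasure (stepLaw ω y) := by
  constructor
  simp only [stepLaw, Measure.coe_finsetSum, Finset.sum_apply, Measure.smul_apply,
    measure_univ, smul_eq_mul, mul_one]
  rw [← ENNReal.ofReal_sum_of_nonneg (fun e _ => (ω y).2.1 e), (ω y).2.2, ENNReal.ofReal_one]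

/-- The transition kernel of the walk in the environment `ω`. -/
noncomputable def stepKernel {d : ℕ} (ω : Environment d) : Kernel (Fin d → ℤ) (Fin d → ℤ) :=
  Kernel.ofFunOfCountable (stepLaw ω)

instance instIsMarkovKernelStepKernel {d : ℕ} (ω : Environment d) :
    IsMarkovKernel (stepKernel ω) :=
  ⟨fun y => instIsProbabilityMeasureStepLaw ω y⟩

/-- The same kernel, viewed as the conditional law of `X_{n+1}` given the path `X_0, …, X_n`;
it only looks at the last site `X_n` of the path. -/
noncomputable def pathKernel {d : ℕ} (ω : Environment d) (n : ℕ) :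
    Kernel (Finset.Iic n → (Fin d → ℤ)) (Fin d → ℤ) :=
  (stepKernel ω).comap (fun h => h ⟨n, Finset.mem_Iic.2 le_rfl⟩) (measurable_pi_apply _)

instance instIsMarkovKernelPathKernel {d : ℕ} (ω : Environment d) (n : ℕ) :
    IsMarkovKernel (pathKernel ω n) := by
  unfold pathKernel; infer_instance

/-- The law `P_{x,ω}` on `(ℤ^d)^ℕ` of the Markov chain started at `x` that jumps from `y` to `y + e`
with probability `ω(y, e)`. -/
noncomputable def walkLaw {d : ℕ} (x : Fin d → ℤ) (ω : Environment d) :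
    Measure (ℕ → (Fin d → ℤ)) :=
  Kernel.trajMeasure (X := fun _ => Fin d → ℤ) (Measure.dirac x) (pathKernel ω)

/-- The box `B_n = {x ∈ ℤ^d : 0 ≤ x_i ≤ n_i - 1 for all i}`. -/
def box {d : ℕ} (n : Fin d → ℕ+) : Set (Fin d → ℤ) :=
  {x | ∀ i, 0 ≤ x i ∧ x i ≤ ((n i : ℕ) : ℤ) - 1}

/-- The coordinatewise residue `x mod n ∈ B_n`. -/
def modBox {d : ℕ} (n : Fin d → ℕ+) (x : Fin d → ℤ) : box n :=
  ⟨fun i => x i % ((n i : ℕ) : ℤ), fun i =>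
    have hn : (0 : ℤ) < ((n i : ℕ) : ℤ) := Int.natCast_pos.2 (n i).pos
    ⟨Int.emod_nonneg _ hn.ne', Int.le_sub_one_of_lt (Int.emod_lt_of_pos _ hn)⟩⟩

/-- The periodic environment `ω_{n,p}(x) = p(x mod n)`. -/
def periodicEnv {d : ℕ} (n : Fin d → ℕ+) (p : box n → JumpLaw d) : Environment d :=
  fun x => p (modBox n x)

/-- The inner product `⟨x, u⟩` of `x ∈ ℤ^d` and `u ∈ ℚ^d`. -/
def height {d : ℕ} (u : Fin d → ℚ) (x : Fin d → ℤ) : ℚ := ∑ i, (x i : ℚ) * u i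

/-- The `(a,b)`-strip perpendicular to `u`. -/
def strip {d : ℕ} (u : Fin d → ℚ) (a b : ℝ) : Set (Fin d → ℤ) :=
  {x | a ≤ (height u x : ℝ) ∧ (height u x : ℝ) < b}

/-- `ω` is the `(u; r_1, …, r_j)`-strip periodic environment generated by `σ_1, …, σ_j`, where
`0 = r_0 < r_1 < ⋯ < r_j`: for every `k ∈ ℤ` the law `σ_l` is used on the strip of all `x` with
`k r_j + r_{l-1} ≤ ⟨x, u⟩ < k r_j + r_l`. (These strips partition `ℤ^d`. The index `l` is
zero-based below, so that `l.castSucc` and `l.succ` index the lower and the upper end.) -/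
def IsStripPeriodicEnv {d j : ℕ} (u : Fin d → ℚ) (r : Fin (j + 1) → ℝ) (σ : Fin j → JumpLaw d)
    (ω : Environment d) : Prop :=
  r 0 = 0 ∧ StrictMono r ∧ ∀ (k : ℤ) (l : Fin j),
    ∀ x ∈ strip u (k * r (Fin.last j) + r l.castSucc) (k * r (Fin.last j) + r l.succ), ω x = σ l

open Classical in
/-- `∑_{i=0}^n 1{X_i ∈ A}`, the number of times `i ≤ n` that the path `X` spends in `A`. -/
noncomputable def visits {d : ℕ} (A : Set (Fin d → ℤ)) (X : ℕ → (Fin d → ℤ)) (n : ℕ) : ℕ :=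
  ((Finset.range (n + 1)).filter (fun i => X i ∈ A)).card

end StripWalk

/-!
The heights `⟨X_n, u⟩` form a martingale with bounded steps, so on a large scale the walk looks like
a one-dimensional diffusion without drift whose variance on the `l`-th strip is `V l`, the variance
of the height of a step with law `σ l`. Such a diffusion has invariant density proportional to
`1 / V l`. Hence the `l`-th strip is given a width of about `W * lam l * V l` with `W` large (plus
one lattice unit, so that every width is positive even where `lam l = 0`).

After clearing denominators, heights and widths are integers, so the environment is a function of the
integer height modulo the total width `N`, and in particular is `N`-periodic in each coordinate.

The occupation times are controlled by a corrector instead of the invariant measure. For fixed `m`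
one would like a periodic function `G` of the height whose expected increment under one step is
`1{l = m} - lam m` on strip `l`. In the continuum this prescribes
`G'' = 2 * (1{l = m} - lam m) / V l`, whose mean over a period vanishes by the choice of the widths.
On the integers the prescribed second difference is enlarged by its total variation over a window
as long as a step (`exists_periodic_corrector`). By discrete convexity (`add_parabola_le`) the
expected increment of `G` is then at least `1{l = m} - lam m`, up to an error equal to the mean of
the enlarged function, which is of order `j / N` because the variation over a period depends on the
number of strips only (`exists_widths`).

Summing over time and using that the compensated sums of a bounded function are `o(n)` almost surely
(`ae_tendsto_compensatedSum_div`), the proportion of time spent in strip `m` is asymptotically at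
most `lam m` plus a small error. As the proportions add up to one, the upper bounds for all strips
yield the lower bounds as well (`abs_sub_le_of_forall_le_add`).
-/

namespace StripWalk

open MeasureTheory ProbabilityTheory Filter Topology

/-! ### Periodic functions on the integers -/

lemma periodic_comp_emod {N : ℕ} {f : ℤ → ℝ} (hf : Function.Periodic f (N : ℤ)) (z : ℤ) :
    f (z % N) = f z := by
  have h := hf.int_mul (-(z / N)) z
  have e : z + -(z / (N : ℤ)) * N = z % N := by
    rw [Int.emod_def]; ring
  rwa [Int.cast_id, e] at h

lemma exists_bound_of_periodic {N : ℕ} (hN : 0 < N) {f : ℤ → ℝ}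
    (hf : Function.Periodic f (N : ℤ)) : ∃ B : ℝ, ∀ z, |f z| ≤ B := by
  refine ⟨∑ i ∈ Finset.range N, |f i|, fun z => ?_⟩
  have h1 : (((z % N).toNat : ℕ) : ℤ) = z % N :=
    Int.toNat_of_nonneg (Int.emod_nonneg _ (by omega))
  have h2 : (z % N).toNat ∈ Finset.range N := by
    have := Int.emod_lt_of_pos z (show (0 : ℤ) < N by omega)
    rw [Finset.mem_range]; omega
  have := Finset.single_le_sum (f := fun i : ℕ => |f i|) (fun i _ => abs_nonneg _) h2
  rwa [h1, periodic_comp_emod hf] at this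

lemma sum_range_add_of_periodic {N : ℕ} {f : ℤ → ℝ} (hf : Function.Periodic f (N : ℤ)) (s : ℤ) :
    ∑ i ∈ Finset.range N, f (i + s) = ∑ i ∈ Finset.range N, f i := by
  have step : ∀ s : ℤ, ∑ i ∈ Finset.range N, f (i + (s + 1)) =
      ∑ i ∈ Finset.range N, f (i + s) := by
    intro s
    have h1 := Finset.sum_range_succ (fun i : ℕ => f (i + s)) N
    have h2 := Finset.sum_range_succ' (fun i : ℕ => f (i + s)) N
    have h3 : f ((N : ℤ) + s) = f (((0 : ℕ) : ℤ) + s) := by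
      rw [add_comm]; simpa using hf s
    have h4 : ∑ i ∈ Finset.range N, f (((i + 1 : ℕ) : ℤ) + s) =
        ∑ i ∈ Finset.range N, f (i + (s + 1)) :=
      Finset.sum_congr rfl fun i _ => by congr 1; push_cast; ring
    linarith
  induction s using Int.induction_on with
  | zero => simp
  | succ i ih => rw [step, ih]
  | pred i ih => rw [← ih, ← step (-(i : ℤ) - 1)]; simp

/-- A periodic function with zero sum over a period is the difference of a periodic function. -/
lemma exists_periodic_primitive {N : ℕ} (hN : 0 < N) {f : ℤ → ℝ}
    (hf : Function.Periodic f (N : ℤ)) (h0 : ∑ i ∈ Finset.range N, f i = 0) :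
    ∃ F : ℤ → ℝ, Function.Periodic F (N : ℤ) ∧ ∀ z, F (z + 1) = F z + f z := by
  refine ⟨fun z => ∑ i ∈ Finset.range (z % N).toNat, f i, fun z => by simp, fun z => ?_⟩
  have hN' : (0 : ℤ) < N := by omega
  have h1 := Int.emod_nonneg z hN'.ne'
  have h2 := Int.emod_lt_of_pos z hN'
  have hfz : f z = f ((z % N).toNat : ℕ) := by
    rw [Int.toNat_of_nonneg h1, periodic_comp_emod hf]
  have h3 : (z + 1) % N = (z % N + 1) % N := by rw [Int.emod_add_emod]
  simp only
  rw [hfz, ← Finset.sum_range_succ]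
  rcases (show z % N + 1 < N ∨ z % N + 1 = N by omega) with h | h
  · rw [h3, Int.emod_eq_of_lt (by omega) h]
    congr 2
    omega
  · rw [h3, h, Int.emod_self]
    have : (z % N).toNat + 1 = N := by omega
    rw [this, h0]; simp

/-- A periodic function with zero sum over a period is the second difference of a periodic
function. -/
lemma exists_periodic_second_primitive {N : ℕ} (hN : 0 < N) {f : ℤ → ℝ}
    (hf : Function.Periodic f (N : ℤ)) (h0 : ∑ i ∈ Finset.range N, f i = 0) :
    ∃ G : ℤ → ℝ, Function.Periodic G (N : ℤ) ∧ ∀ z, G (z + 1) - 2 * G z + G (z - 1) = f z := by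
  obtain ⟨F, hF, hFf⟩ := exists_periodic_primitive hN hf h0
  set c : ℝ := (∑ i ∈ Finset.range N, F i) / N with hc
  have hNR : (N : ℝ) ≠ 0 := by positivity
  obtain ⟨G, hG, hGF⟩ := exists_periodic_primitive hN (f := fun z => F z - c)
    (fun z => by simp only [hF z]) (by
      rw [Finset.sum_sub_distrib]
      simp only [Finset.sum_const, Finset.card_range, nsmul_eq_mul, hc]
      field_simp
      ring)
  refine ⟨fun z => G (z + 1), fun z => by
    simp only [show z + (N : ℤ) + 1 = z + 1 + N by ring, hG (z + 1)], fun z => ?_⟩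
  have h1 := hGF (z + 1)
  have h2 := hGF z
  have h3 := hFf z
  simp only [sub_add_cancel] at *
  linarith

/-! ### Discrete second-order expansion -/

/-- A function on `ℕ` with nonnegative first increment and nonnegative second differences
on `[0, K]` is at least its initial value. -/
lemma le_of_second_difference_nonneg {H : ℕ → ℝ} {K : ℕ} (h1 : H 0 ≤ H 1)
    (h2 : ∀ n, n + 1 ≤ K → 0 ≤ H (n + 2) - 2 * H (n + 1) + H n) {n : ℕ} (hn : n ≤ K) :
    H 0 ≤ H n := by
  have mono : ∀ n, n ≤ K → H n ≤ H (n + 1) := by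
    intro n
    induction n with
    | zero => intro _; simpa using h1
    | succ n ih =>
      intro hn
      have := ih (by omega)
      have := h2 n hn
      linarith
  induction n with
  | zero => exact le_rfl
  | succ n ih => exact (ih (by omega)).trans (mono n (by omega))

/-- If the second difference of `G` is at least `m` within distance `K` of `z`, then `G` lies above
the parabola with central slope at `z` and second derivative `m`. -/
lemma add_parabola_le {G : ℤ → ℝ} {z : ℤ} {K : ℕ} {m : ℝ}
    (h : ∀ t : ℤ, |t| ≤ K → m ≤ G (z + t + 1) - 2 * G (z + t) + G (z + t - 1))
    {s : ℤ} (hs : |s| ≤ K) :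
    s * ((G (z + 1) - G (z - 1)) / 2) + (s : ℝ) ^ 2 * (m / 2) ≤ G (z + s) - G z := by
  set D : ℝ := (G (z + 1) - G (z - 1)) / 2 with hD
  have h0 := h 0 (by simp)
  simp only [add_zero] at h0
  have key : ∀ η : ℤ, η = 1 ∨ η = -1 → ∀ n : ℕ, n ≤ K →
      G z ≤ G (z + η * n) - (η * n : ℤ) * D - ((η * n : ℤ) : ℝ) ^ 2 * (m / 2) := by
    intro η hη n hn
    have := le_of_second_difference_nonneg (K := K)
      (H := fun n : ℕ => G (z + η * n) - (η * n : ℤ) * D - ((η * n : ℤ) : ℝ) ^ 2 * (m / 2))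
      ?_ ?_ hn
    · simpa using this
    · rcases hη with rfl | rfl
      · simp; linarith
      · simp [← sub_eq_add_neg]; linarith
    · intro k hk
      have := h (η * (k + 1)) (by
        rcases hη with rfl | rfl
        · rw [abs_of_nonneg] <;> omega
        · rw [abs_of_nonpos] <;> omega)
      rcases hη with rfl | rfl
      · push_cast
        rw [show z + 1 * ((k : ℤ) + 2) = z + 1 * (k + 1) + 1 by ring,
          show z + 1 * (k : ℤ) = z + 1 * (k + 1) - 1 by ring]
        linarith
      · push_cast
        rw [show z + -1 * ((k : ℤ) + 2) = z + -1 * (k + 1) - 1 by ring,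
          show z + -1 * (k : ℤ) = z + -1 * (k + 1) + 1 by ring]
        linarith
  rcases le_total 0 s with h' | h'
  · lift s to ℕ using h'
    have := key 1 (Or.inl rfl) s (by simpa using hs)
    simp only [one_mul] at this
    linarith
  · obtain ⟨n, rfl⟩ : ∃ n : ℕ, s = -(n : ℤ) := ⟨(-s).toNat, by omega⟩
    have := key (-1) (Or.inr rfl) n (by simpa using hs)
    simp only [neg_mul, one_mul] at this
    linarith

/-- Correctors for a periodic function `b`: if `b` has small sum and small total variation over a
period, there is a periodic `G` lying above each parabola of second derivative `b z - c` at `z`,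
within distance `K`, with small `c`. The second difference of `G` is `b` plus its variation over
a window of radius `K`, minus the mean. -/
lemma exists_periodic_corrector {N : ℕ} (hN : 0 < N) (K : ℕ) {b : ℤ → ℝ}
    (hb : Function.Periodic b (N : ℤ)) {E D : ℝ} (hE : ∑ i ∈ Finset.range N, b i ≤ E)
    (hD : ∑ i ∈ Finset.range N, |b i - b (i - 1)| ≤ D) :
    ∃ G : ℤ → ℝ, Function.Periodic G (N : ℤ) ∧ ∀ z s : ℤ, |s| ≤ K →
      s * ((G (z + 1) - G (z - 1)) / 2) + (s : ℝ) ^ 2 * ((b z - (E + 2 * K * D) / N) / 2)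
        ≤ G (z + s) - G z := by
  set δ : ℤ → ℝ := fun z => |b z - b (z - 1)| with hδ
  have hδp : Function.Periodic δ (N : ℤ) := fun z => by
    simp only [hδ, hb z, show z + (N : ℤ) - 1 = z - 1 + N by ring, hb (z - 1)]
  have hδ0 : ∀ z, 0 ≤ δ z := fun z => abs_nonneg _
  set a : ℤ → ℝ := fun z =>
    b z + ∑ i ∈ Finset.range K, (δ (z + (i + 1)) + δ (z + (-i))) with ha
  have hap : Function.Periodic a (N : ℤ) := fun z => by
    simp only [ha, hb z]
    congr 1
    refine Finset.sum_congr rfl fun i _ => ?_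
    rw [show z + (N : ℤ) + (i + 1) = z + (i + 1) + N by ring,
      show z + (N : ℤ) + -i = z + (-i) + N by ring, hδp, hδp]
  have up : ∀ (z : ℤ) (n : ℕ), b (z + n) ≤ b z + ∑ i ∈ Finset.range n, δ (z + (i + 1)) := by
    intro z n
    induction n with
    | zero => simp
    | succ n ih =>
      rw [Finset.sum_range_succ]
      have := le_abs_self (b (z + (n + 1)) - b (z + (n + 1) - 1))
      rw [show z + ((n : ℤ) + 1) - 1 = z + n by ring] at this
      simp only [hδ] at *
      push_cast
      rw [show z + ((n : ℤ) + 1) - 1 = z + n by ring]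
      linarith
  have down : ∀ (z : ℤ) (n : ℕ), b (z - n) ≤ b z + ∑ i ∈ Finset.range n, δ (z + (-i)) := by
    intro z n
    induction n with
    | zero => simp
    | succ n ih =>
      rw [Finset.sum_range_succ]
      have := neg_abs_le (b (z + -n) - b (z + -n - 1))
      simp only [hδ] at *
      push_cast
      rw [show z - ((n : ℤ) + 1) = z + -n - 1 by ring]
      rw [show z - (n : ℤ) = z + -n by ring] at ih
      linarith
  have maj : ∀ z t : ℤ, |t| ≤ K → b z ≤ a (z + t) := by
    intro z t ht
    have hsum : ∀ n ≤ K, ∀ f : ℕ → ℤ, ∑ i ∈ Finset.range n, δ (f i) ≤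
        ∑ i ∈ Finset.range K, δ (f i) := fun n hn f =>
      Finset.sum_le_sum_of_subset_of_nonneg (by simpa using hn) fun i _ _ => hδ0 _
    have hnn : ∀ f : ℕ → ℤ, 0 ≤ ∑ i ∈ Finset.range K, δ (f i) := fun f =>
      Finset.sum_nonneg fun i _ => hδ0 _
    simp only [ha, Finset.sum_add_distrib]
    have p1 := hnn fun i => z + t + (i + 1)
    have p2 := hnn fun i => z + t + -i
    rcases le_total 0 t with h' | h'
    · lift t to ℕ using h'
      have h1 := down (z + t) t
      have h2 := hsum t (by simpa using ht) fun i => z + t + -i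
      rw [add_sub_cancel_right] at h1
      linarith
    · obtain ⟨n, rfl⟩ : ∃ n : ℕ, t = -(n : ℤ) := ⟨(-t).toNat, by omega⟩
      have h1 := up (z + -n) n
      have h2 := hsum n (by simpa using ht) fun i => z + -n + (i + 1)
      rw [neg_add_cancel_right] at h1
      linarith
  have hsumδ : ∀ s : ℤ, ∑ i ∈ Finset.range N, δ (i + s) ≤ D := fun s => by
    rw [sum_range_add_of_periodic hδp]; exact hD
  have hsuma : ∑ i ∈ Finset.range N, a i ≤ E + 2 * K * D := by
    simp only [ha, Finset.sum_add_distrib]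
    rw [Finset.sum_comm, Finset.sum_comm (s := Finset.range N)]
    have h1 := Finset.sum_le_card_nsmul (Finset.range K)
      (fun i : ℕ => ∑ z ∈ Finset.range N, δ (z + ((i : ℤ) + 1))) D fun i _ => hsumδ _
    have h2 := Finset.sum_le_card_nsmul (Finset.range K)
      (fun i : ℕ => ∑ z ∈ Finset.range N, δ (z + (-(i : ℤ)))) D fun i _ => hsumδ _
    simp only [Finset.card_range, nsmul_eq_mul] at h1 h2
    linarith
  have hNR : (0 : ℝ) < N := by positivity
  set c : ℝ := (∑ i ∈ Finset.range N, a i) / N with hc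
  have hcle : c ≤ (E + 2 * K * D) / N := by rw [hc]; gcongr
  obtain ⟨G, hG, hGa⟩ := exists_periodic_second_primitive hN (f := fun z => a z - c)
    (fun z => by simp only [hap z]) (by
      rw [Finset.sum_sub_distrib]
      simp only [Finset.sum_const, Finset.card_range, nsmul_eq_mul, hc]
      field_simp
      ring)
  refine ⟨G, hG, fun z s hs => add_parabola_le (fun t ht => ?_) hs⟩
  rw [hGa (z + t)]
  linarith [maj z t ht]

/-! ### Strips of integer width -/

/-- The left end `w 0 + ⋯ + w (k - 1)` of the `k`-th of consecutive intervals of lengths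
`w 0, w 1, …`. -/
def stripStart (w : ℕ → ℕ) (k : ℕ) : ℕ := ∑ i ∈ Finset.range k, w i

/-- The index `k` of the interval `[stripStart w k, stripStart w (k + 1))` that contains `t`,
provided that all lengths are positive. -/
def stripIndex (w : ℕ → ℕ) (t : ℕ) : ℕ := Nat.findGreatest (fun k => stripStart w k ≤ t) t

lemma stripStart_succ (w : ℕ → ℕ) (k : ℕ) : stripStart w (k + 1) = stripStart w k + w k :=
  Finset.sum_range_succ _ _

lemma stripStart_strictMono {w : ℕ → ℕ} (hw : ∀ i, 0 < w i) : StrictMono (stripStart w) :=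
  strictMono_nat_of_lt_succ fun k => by
    rw [stripStart_succ]; exact Nat.lt_add_of_pos_right (hw k)

lemma stripIndex_eq {w : ℕ → ℕ} (hw : ∀ i, 0 < w i) {k t : ℕ} (h1 : stripStart w k ≤ t)
    (h2 : t < stripStart w (k + 1)) : stripIndex w t = k := by
  rw [stripIndex, Nat.findGreatest_eq_iff]
  refine ⟨((stripStart_strictMono hw).le_apply).trans h1, fun _ => h1, fun n hn _ h => ?_⟩
  have := (stripStart_strictMono hw).monotone (show k + 1 ≤ n from hn)
  omega

lemma stripStart_stripIndex_le (w : ℕ → ℕ) (t : ℕ) : stripStart w (stripIndex w t) ≤ t :=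
  Nat.findGreatest_spec (P := fun k => stripStart w k ≤ t) (Nat.zero_le t)
    (by simp [stripStart])

lemma stripIndex_lt {w : ℕ → ℕ} (hw : ∀ i, 0 < w i) {k t : ℕ} (h : t < stripStart w k) :
    stripIndex w t < k :=
  (stripStart_strictMono hw).lt_iff_lt.1 ((stripStart_stripIndex_le w t).trans_lt h)

lemma stripIndex_mono (w : ℕ → ℕ) : Monotone (stripIndex w) := fun _ _ h =>
  Nat.findGreatest_mono (fun _ hk => hk.trans h) h

lemma sum_stripIndex {w : ℕ → ℕ} (hw : ∀ i, 0 < w i) (β : ℕ → ℝ) (k : ℕ) :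
    ∑ t ∈ Finset.range (stripStart w k), β (stripIndex w t) =
      ∑ i ∈ Finset.range k, w i * β i := by
  induction k with
  | zero => simp [stripStart]
  | succ k ih =>
    rw [stripStart_succ, Finset.sum_range_add, ih, Finset.sum_range_succ]
    congr 1
    rw [Finset.sum_congr rfl (g := fun _ => β k) fun i hi => ?_]
    · simp
    · rw [stripIndex_eq hw (Nat.le_add_right _ _)]
      rw [stripStart_succ]
      have := Finset.mem_range.1 hi
      omega

/-- The `N`-periodic extension to `ℤ` of the sequence `β (stripIndex w t)`, `0 ≤ t < N`. -/
def stripFun (w : ℕ → ℕ) (N : ℕ) (β : ℕ → ℝ) (z : ℤ) : ℝ := β (stripIndex w (z % N).toNat)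

lemma stripFun_periodic (w : ℕ → ℕ) (N : ℕ) (β : ℕ → ℝ) :
    Function.Periodic (stripFun w N β) (N : ℤ) := fun z => by simp [stripFun]

lemma stripFun_natCast (w : ℕ → ℕ) {N : ℕ} (β : ℕ → ℝ) {t : ℕ} (ht : t < N) :
    stripFun w N β t = β (stripIndex w t) := by
  rw [stripFun, Int.emod_eq_of_lt (by omega) (by omega)]
  simp

/-- The variation over a period is controlled by the number of strips, not by their widths. -/
lemma sum_abs_stripFun_sub_le {w : ℕ → ℕ} (hw : ∀ i, 0 < w i) {j : ℕ} (hj : 1 ≤ j) {β : ℕ → ℝ}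
    {B : ℝ} (hB : ∀ i, |β i| ≤ B) :
    ∑ t ∈ Finset.range (stripStart w j),
      |stripFun w (stripStart w j) β t - stripFun w (stripStart w j) β (t - 1)| ≤ 2 * B * j := by
  have hsub : ∀ k l, |β k - β l| ≤ 2 * B := fun k l =>
    (abs_sub _ _).trans (by linarith [hB k, hB l])
  have hB0 : 0 ≤ B := (abs_nonneg _).trans (hB 0)
  obtain ⟨M, hM⟩ : ∃ M, stripStart w j = M + 1 := Nat.exists_eq_succ_of_ne_zero (by
    have := (stripStart_strictMono hw).le_apply (x := j); omega)
  have hidx : stripIndex w M < j := stripIndex_lt hw (by omega)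
  rw [hM, Finset.sum_range_succ']
  have h1 : ∀ n ≤ M, ∑ t ∈ Finset.range n,
      |stripFun w (M + 1) β ((t + 1 : ℕ) : ℤ) - stripFun w (M + 1) β (((t + 1 : ℕ) : ℤ) - 1)| ≤
        2 * B * stripIndex w n := by
    intro n
    induction n with
    | zero => intro _; simp; positivity
    | succ n ih =>
      intro hn
      rw [Finset.sum_range_succ, show (((n + 1 : ℕ) : ℤ) - 1) = (n : ℕ) by push_cast; ring,
        stripFun_natCast w β (by omega), stripFun_natCast w β (by omega)]
      have := ih (by omega)
      rcases (stripIndex_mono w (Nat.le_succ n)).eq_or_lt with h | h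
      · rw [Nat.succ_eq_add_one] at h
        rw [← h, sub_self, abs_zero, add_zero]; exact this
      · have h2 : (stripIndex w n : ℝ) + 1 ≤ stripIndex w (n + 1) := by exact_mod_cast h
        have := hsub (stripIndex w (n + 1)) (stripIndex w n)
        nlinarith
  have h2 := h1 M le_rfl
  -- The remaining term is the jump across the end of the period.
  have h3 : |stripFun w (M + 1) β ((0 : ℕ) : ℤ) -
      stripFun w (M + 1) β (((0 : ℕ) : ℤ) - 1)| ≤ 2 * B := hsub _ _
  have h4 : (stripIndex w M : ℝ) + 1 ≤ j := by exact_mod_cast hidx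
  nlinarith

/-- If the `l`-th of `j` strips has width about `W * lam l * V l`, with `W` large, then for every
`m < j` there is a periodic corrector whose value under a centred step of variance `V l` started in
strip `l` increases by at least `1{l = m} - lam m - ε`. -/
lemma exists_widths {j : ℕ} (hj : 1 ≤ j) (K : ℕ) {V lam : ℕ → ℝ} {v : ℝ} (hv : 0 < v)
    (hV : ∀ i, v ≤ V i) (hVK : ∀ i, V i ≤ (K : ℝ) ^ 2) (hlam0 : ∀ i, 0 ≤ lam i)
    (hlam : ∑ i ∈ Finset.range j, lam i = 1) {ε : ℝ} (hε : 0 < ε) :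
    ∃ w : ℕ → ℕ, (∀ i, 0 < w i) ∧ ∀ m < j, ∃ G : ℤ → ℝ,
      Function.Periodic G (stripStart w j : ℤ) ∧ ∀ z : ℤ, ∃ D c : ℝ,
        (∀ s : ℤ, |s| ≤ K → s * D + (s : ℝ) ^ 2 * c ≤ G (z + s) - G z) ∧
        (if stripIndex w (z % stripStart w j).toNat = m then 1 else 0) - lam m - ε ≤
          c * V (stripIndex w (z % stripStart w j).toNat) := by
  set B : ℝ := 2 / v with hB
  have hB0 : 0 < B := by positivity
  -- `C / N` is the mean of the enlarged second difference: `j * B` comes from rounding the widths,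
  -- the rest from the total variation over a period.
  set C : ℝ := j * B + 2 * K * (2 * B * j) with hC
  have hC0 : 0 ≤ C := by positivity
  set W : ℝ := C * (K : ℝ) ^ 2 / (v * ε) with hW
  have hW0 : 0 ≤ W := by positivity
  have hV0 : ∀ i, 0 < V i := fun i => hv.trans_le (hV i)
  set w : ℕ → ℕ := fun i => ⌊W * lam i * V i⌋₊ + 1 with hwdef
  have hw : ∀ i, 0 < w i := fun i => Nat.succ_pos _
  have hw1 : ∀ i, W * lam i * V i ≤ w i := fun i => by
    have := (Nat.lt_floor_add_one (W * lam i * V i)).le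
    simpa [hwdef] using this
  have hw2 : ∀ i, (w i : ℝ) ≤ W * lam i * V i + 1 := fun i => by
    have := Nat.floor_le (mul_nonneg (mul_nonneg hW0 (hlam0 i)) (hV0 i).le)
    simpa [hwdef] using this
  set N := stripStart w j with hN
  have hNpos : 0 < N := by
    have := (stripStart_strictMono hw).le_apply (x := j); omega
  have hNW : W * v ≤ N := by
    calc W * v = ∑ i ∈ Finset.range j, W * lam i * v := by
          rw [← Finset.sum_mul, ← Finset.mul_sum, hlam, mul_one]
      _ ≤ ∑ i ∈ Finset.range j, (w i : ℝ) := Finset.sum_le_sum fun i _ =>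
          (mul_le_mul_of_nonneg_left (hV i) (mul_nonneg hW0 (hlam0 i))).trans (hw1 i)
      _ = N := by rw [hN, stripStart]; push_cast; rfl
  refine ⟨w, hw, fun m hm => ?_⟩
  have hm1 : lam m ≤ 1 := by
    rw [← hlam]
    exact Finset.single_le_sum (f := lam) (fun i _ => hlam0 i) (Finset.mem_range.2 hm)
  -- Second derivative on strip `i` of the function solving `½ V g'' = 1{i = m} - lam m`.
  set β : ℕ → ℝ := fun i => 2 * ((if i = m then 1 else 0) - lam m) / V i with hβ
  have hβB : ∀ i, |β i| ≤ B := fun i => by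
    have h1 : |(if i = m then (1 : ℝ) else 0) - lam m| ≤ 1 := by
      have := hlam0 m
      split_ifs <;> rw [abs_le] <;> constructor <;> linarith
    rw [hβ, hB, abs_div, abs_mul, abs_of_pos (hV0 i), abs_two]
    exact div_le_div₀ two_pos.le (by linarith) hv (hV i)
  have hE : ∑ t ∈ Finset.range N, stripFun w N β t ≤ j * B := by
    rw [Finset.sum_congr rfl fun t ht => stripFun_natCast w β (Finset.mem_range.1 ht),
      sum_stripIndex hw]
    calc ∑ i ∈ Finset.range j, w i * β i
        ≤ ∑ i ∈ Finset.range j, (2 * W * (lam i * ((if i = m then 1 else 0) - lam m)) + B) := by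
          refine Finset.sum_le_sum fun i _ => ?_
          have e1 : W * lam i * V i * β i =
              2 * W * (lam i * ((if i = m then 1 else 0) - lam m)) := by
            have := (hV0 i).ne'
            simp only [hβ]
            field_simp
          have h1 := abs_le.1 (hβB i)
          have h2 : (w i - W * lam i * V i) * β i ≤ 1 * B :=
            (mul_le_mul_of_nonneg_left h1.2 (by linarith [hw1 i])).trans
              (mul_le_mul_of_nonneg_right (by linarith [hw2 i]) hB0.le)
          linarith
      _ = j * B := by
          rw [Finset.sum_add_distrib, ← Finset.mul_sum]
          simp only [mul_sub, Finset.sum_sub_distrib, ← Finset.sum_mul, hlam]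
          simp [hm]
  obtain ⟨G, hG, hGs⟩ := exists_periodic_corrector hNpos K (stripFun_periodic w N β) hE
    (sum_abs_stripFun_sub_le hw hj hβB)
  refine ⟨G, hG, fun z => ⟨_, _, hGs z, ?_⟩⟩
  set i := stripIndex w (z % N).toNat with hi
  have e : stripFun w N β z = β i := rfl
  rw [e, ← hC]
  have hN0 : (0 : ℝ) < N := by exact_mod_cast hNpos
  have e1 : β i * V i = 2 * ((if i = m then 1 else 0) - lam m) := by
    simp only [hβ]
    exact div_mul_cancel₀ _ (hV0 i).ne'
  have h1 : C * (K : ℝ) ^ 2 ≤ ε * N := by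
    have : ε * (W * v) = C * (K : ℝ) ^ 2 := by rw [hW]; field_simp
    rw [← this]; gcongr
  have h2 : C / N * V i ≤ ε := by
    rw [div_mul_eq_mul_div, div_le_iff₀ hN0]
    exact (mul_le_mul_of_nonneg_left (hVK i) hC0).trans h1
  have h3 : 0 ≤ C / N * V i := mul_nonneg (by positivity) (hV0 i).le
  linarith

/-! ### A law of large numbers for the walk -/

/-- The expected value of `h` after one step from `x`. -/
noncomputable def stepMean {d : ℕ} (ω : Environment d) (h : (Fin d → ℤ) → ℝ) (x : Fin d → ℤ) : ℝ :=
  ∑ e : UnitVec d, (ω x).1 e * h (x + e.1)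

lemma integral_stepLaw {d : ℕ} (ω : Environment d) (h : (Fin d → ℤ) → ℝ) (x : Fin d → ℤ) :
    ∫ y, h y ∂(stepLaw ω x) = stepMean ω h x := by
  rw [stepLaw, integral_finsetSum_measure]
  · refine Finset.sum_congr rfl fun e _ => ?_
    rw [integral_smul_measure, integral_dirac, ENNReal.toReal_ofReal ((ω x).2.1 e), smul_eq_mul]
  · intro e _
    exact (integrable_dirac (by simp)).smul_measure ENNReal.ofReal_ne_top

lemma abs_stepMean_le {d : ℕ} (ω : Environment d) {h : (Fin d → ℤ) → ℝ} {B : ℝ}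
    (hB : ∀ x, |h x| ≤ B) (x : Fin d → ℤ) : |stepMean ω h x| ≤ B := by
  calc |stepMean ω h x| ≤ ∑ e : UnitVec d, |(ω x).1 e * h (x + e.1)| :=
        Finset.abs_sum_le_sum_abs _ _
    _ ≤ ∑ e : UnitVec d, (ω x).1 e * B := Finset.sum_le_sum fun e _ => by
        rw [abs_mul, abs_of_nonneg ((ω x).2.1 e)]
        exact mul_le_mul_of_nonneg_left (hB _) ((ω x).2.1 e)
    _ = B := by rw [← Finset.sum_mul, (ω x).2.2, one_mul]

instance instIsProbabilityMeasureWalkLaw {d : ℕ} (x : Fin d → ℤ) (ω : Environment d) :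
    IsProbabilityMeasure (walkLaw x ω) := by
  unfold walkLaw; infer_instance

/-- The increments `h (X_{n+1}) - E[h (X_{n+1}) | X_n]` are orthogonal to bounded functions of the
past. -/
lemma integral_mul_increment_eq_zero {d : ℕ} (x : Fin d → ℤ) (ω : Environment d)
    {h : (Fin d → ℤ) → ℝ} {B : ℝ} (hB : ∀ x, |h x| ≤ B) (n : ℕ)
    {F : (Finset.Iic n → (Fin d → ℤ)) → ℝ} {A : ℝ} (hA : ∀ y, |F y| ≤ A) :
    ∫ X, F (Preorder.frestrictLe n X) * (h (X (n + 1)) - stepMean ω h (X n))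
      ∂(walkLaw x ω) = 0 := by
  set Φ : (Finset.Iic n → (Fin d → ℤ)) × (Fin d → ℤ) → ℝ := fun p =>
    F p.1 * (h p.2 - stepMean ω h (p.1 ⟨n, Finset.mem_Iic.2 le_rfl⟩)) with hΦ
  have hΦm : Measurable Φ := Measurable.of_discrete
  have hΦb : ∀ p, ‖Φ p‖ ≤ A * (B + B) := fun p => by
    rw [hΦ, Real.norm_eq_abs, abs_mul]
    exact mul_le_mul (hA _) ((abs_sub _ _).trans (add_le_add (hB _) (abs_stepMean_le ω hB _)))
      (abs_nonneg _) ((abs_nonneg _).trans (hA p.1))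
  have hmap := Kernel.map_frestrictLe_trajMeasure_compProd_eq_map_trajMeasure
    (X := fun _ => Fin d → ℤ) (μ₀ := Measure.dirac x) (κ := pathKernel ω) (a := n)
  have hmeas : Measurable (fun X : ℕ → (Fin d → ℤ) =>
      ((Preorder.frestrictLe n X : Finset.Iic n → (Fin d → ℤ)), X (n + 1))) := by fun_prop
  have h1 : ∫ X, F (Preorder.frestrictLe n X) * (h (X (n + 1)) - stepMean ω h (X n))
      ∂(walkLaw x ω) = ∫ X, Φ (Preorder.frestrictLe n X, X (n + 1)) ∂(walkLaw x ω) := rfl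
  rw [h1, ← integral_map (φ := fun X : ℕ → (Fin d → ℤ) =>
      ((Preorder.frestrictLe n X : Finset.Iic n → (Fin d → ℤ)), X (n + 1)))
    hmeas.aemeasurable hΦm.aestronglyMeasurable, walkLaw, ← hmap]
  have : IsProbabilityMeasure ((Kernel.trajMeasure (X := fun _ => Fin d → ℤ) (Measure.dirac x)
      (pathKernel ω)).map (Preorder.frestrictLe n)) :=
    Measure.isProbabilityMeasure_map (by fun_prop)
  rw [Measure.integral_compProd (Integrable.of_bound hΦm.aestronglyMeasurable _
    (Eventually.of_forall hΦb))]
  have h2 : ∀ y : Finset.Iic n → (Fin d → ℤ), ∫ z, Φ (y, z) ∂(pathKernel ω n y) = 0 := by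
    intro y
    have hk : pathKernel ω n y = stepLaw ω (y ⟨n, Finset.mem_Iic.2 le_rfl⟩) := rfl
    have hi : Integrable h (stepLaw ω (y ⟨n, Finset.mem_Iic.2 le_rfl⟩)) :=
      Integrable.of_bound Measurable.of_discrete.aestronglyMeasurable B (Eventually.of_forall hB)
    simp only [hΦ, hk]
    rw [integral_const_mul, integral_sub hi (integrable_const _), integral_stepLaw]
    simp
  simp [h2]

/-- The martingale `∑_{i<n} (h (X_{i+1}) - E[h (X_{i+1}) | X_i])`. -/
noncomputable def compensatedSum {d : ℕ} (ω : Environment d) (h : (Fin d → ℤ) → ℝ)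
    (X : ℕ → (Fin d → ℤ)) (n : ℕ) : ℝ :=
  ∑ i ∈ Finset.range n, (h (X (i + 1)) - stepMean ω h (X i))

lemma measurable_compensatedSum {d : ℕ} (ω : Environment d) (h : (Fin d → ℤ) → ℝ) (n : ℕ) :
    Measurable fun X => compensatedSum ω h X n := by
  unfold compensatedSum
  refine Finset.measurable_sum _ fun i _ => Measurable.sub ?_ ?_
  · exact (Measurable.of_discrete (f := h)).comp (measurable_pi_apply _)
  · exact (Measurable.of_discrete (f := stepMean ω h)).comp (measurable_pi_apply _)

lemma abs_increment_le {d : ℕ} (ω : Environment d) {h : (Fin d → ℤ) → ℝ} {B : ℝ}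
    (hB : ∀ x, |h x| ≤ B) (x y : Fin d → ℤ) : |h y - stepMean ω h x| ≤ 2 * B :=
  (abs_sub _ _).trans (by linarith [hB y, abs_stepMean_le ω hB x])

lemma abs_compensatedSum_le {d : ℕ} (ω : Environment d) {h : (Fin d → ℤ) → ℝ} {B : ℝ}
    (hB : ∀ x, |h x| ≤ B) (X : ℕ → (Fin d → ℤ)) (n : ℕ) :
    |compensatedSum ω h X n| ≤ n * (2 * B) := by
  refine (Finset.abs_sum_le_sum_abs _ _).trans ?_
  have := Finset.sum_le_card_nsmul (Finset.range n)
    (fun i => |h (X (i + 1)) - stepMean ω h (X i)|) (2 * B) fun i _ => abs_increment_le ω hB _ _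
  simpa using this

lemma integrable_sq_compensatedSum {d : ℕ} (x : Fin d → ℤ) (ω : Environment d)
    {h : (Fin d → ℤ) → ℝ} {B : ℝ} (hB : ∀ x, |h x| ≤ B) (n : ℕ) :
    Integrable (fun X => compensatedSum ω h X n ^ 2) (walkLaw x ω) :=
  Integrable.of_bound ((measurable_compensatedSum ω h n).pow_const 2).aestronglyMeasurable
    ((n * (2 * B)) ^ 2) (Eventually.of_forall fun X => by
      rw [Real.norm_eq_abs, abs_pow]
      exact pow_le_pow_left₀ (abs_nonneg _) (abs_compensatedSum_le ω hB X n) 2)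

lemma integral_sq_compensatedSum_le {d : ℕ} (x : Fin d → ℤ) (ω : Environment d)
    {h : (Fin d → ℤ) → ℝ} {B : ℝ} (hB : ∀ x, |h x| ≤ B) (n : ℕ) :
    ∫ X, compensatedSum ω h X n ^ 2 ∂(walkLaw x ω) ≤ n * (2 * B) ^ 2 := by
  induction n with
  | zero => simp [compensatedSum]
  | succ n ih =>
    -- The past of the path is extended by zero to evaluate the martingale on it.
    set F : (Finset.Iic n → (Fin d → ℤ)) → ℝ := fun y =>
      compensatedSum ω h (fun k => if hk : k ≤ n then y ⟨k, Finset.mem_Iic.2 hk⟩ else 0) n with hF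
    have hFX : ∀ X : ℕ → (Fin d → ℤ),
        F (Preorder.frestrictLe n X) = compensatedSum ω h X n := fun X => by
      simp only [hF, compensatedSum]
      refine Finset.sum_congr rfl fun i hi => ?_
      have hi := Finset.mem_range.1 hi
      simp [hi.le, Nat.succ_le_of_lt hi]
    have horth := integral_mul_increment_eq_zero x ω hB n
      (fun y => abs_compensatedSum_le ω hB
        (fun k => if hk : k ≤ n then y ⟨k, Finset.mem_Iic.2 hk⟩ else 0) n)
    change ∫ X, F (Preorder.frestrictLe (π := fun _ => Fin d → ℤ) n X) * _ ∂_ = 0 at horth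
    simp only [hFX] at horth
    have hinc : Measurable fun X : ℕ → (Fin d → ℤ) => h (X (n + 1)) - stepMean ω h (X n) :=
      ((Measurable.of_discrete (f := h)).comp (measurable_pi_apply _)).sub
        ((Measurable.of_discrete (f := stepMean ω h)).comp (measurable_pi_apply _))
    have hI : Integrable (fun X => compensatedSum ω h X n *
        (h (X (n + 1)) - stepMean ω h (X n))) (walkLaw x ω) :=
      Integrable.of_bound ((measurable_compensatedSum ω h n).mul hinc).aestronglyMeasurable
        (n * (2 * B) * (2 * B)) (Eventually.of_forall fun X => by
          rw [Real.norm_eq_abs, abs_mul]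
          exact mul_le_mul (abs_compensatedSum_le ω hB X n) (abs_increment_le ω hB _ _)
            (abs_nonneg _) ((abs_nonneg _).trans (abs_compensatedSum_le ω hB X n)))
    calc ∫ X, compensatedSum ω h X (n + 1) ^ 2 ∂(walkLaw x ω)
        ≤ ∫ X, (compensatedSum ω h X n ^ 2 + 2 * (compensatedSum ω h X n *
            (h (X (n + 1)) - stepMean ω h (X n))) + (2 * B) ^ 2) ∂(walkLaw x ω) := by
          refine integral_mono (integrable_sq_compensatedSum x ω hB (n + 1))
            (((integrable_sq_compensatedSum x ω hB n).add (hI.const_mul 2)).add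
              (integrable_const _)) fun X => ?_
          have h1 : compensatedSum ω h X (n + 1) =
              compensatedSum ω h X n + (h (X (n + 1)) - stepMean ω h (X n)) :=
            Finset.sum_range_succ _ _
          have h2 := sq_le_sq' (abs_le.1 (abs_increment_le ω hB (X n) (X (n + 1)))).1
            (abs_le.1 (abs_increment_le ω hB (X n) (X (n + 1)))).2
          simp only [h1]
          linarith
      _ = ∫ X, compensatedSum ω h X n ^ 2 ∂(walkLaw x ω) + (2 * B) ^ 2 := by
          have h12 : Integrable (fun X => compensatedSum ω h X n ^ 2 + 2 * (compensatedSum ω h X n *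
              (h (X (n + 1)) - stepMean ω h (X n)))) (walkLaw x ω) :=
            (integrable_sq_compensatedSum x ω hB n).add (hI.const_mul 2)
          rw [integral_add h12 (integrable_const _),
            integral_add (integrable_sq_compensatedSum x ω hB n) (hI.const_mul 2),
            integral_const_mul, horth]
          simp
      _ ≤ ((n + 1 : ℕ) : ℝ) * (2 * B) ^ 2 := by push_cast; linarith

/-- The second moments are summable along the squares, which gives convergence there. -/
lemma ae_tendsto_compensatedSum_sq_div {d : ℕ} (x : Fin d → ℤ) (ω : Environment d)
    {h : (Fin d → ℤ) → ℝ} {B : ℝ} (hB : ∀ x, |h x| ≤ B) :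
    ∀ᵐ X ∂(walkLaw x ω), Tendsto
      (fun n : ℕ => compensatedSum ω h X (n ^ 2) / ((n ^ 2 : ℕ) : ℝ)) atTop (𝓝 0) := by
  set f : ℕ → (ℕ → (Fin d → ℤ)) → ENNReal := fun n X =>
    ENNReal.ofReal ((compensatedSum ω h X (n ^ 2) / ((n ^ 2 : ℕ) : ℝ)) ^ 2) with hf
  have hfm : ∀ n, Measurable (f n) := fun n =>
    (((measurable_compensatedSum ω h _).div_const _).pow_const 2).ennreal_ofReal
  have hfi : ∀ n, ∫⁻ X, f n X ∂(walkLaw x ω) ≤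
      ENNReal.ofReal ((2 * B) ^ 2 * (1 / (n : ℝ) ^ 2)) := by
    intro n
    have hi : Integrable (fun X => (compensatedSum ω h X (n ^ 2) / ((n ^ 2 : ℕ) : ℝ)) ^ 2)
        (walkLaw x ω) := by
      simp only [div_pow]
      exact (integrable_sq_compensatedSum x ω hB (n ^ 2)).div_const _
    rw [← ofReal_integral_eq_lintegral_ofReal hi (Eventually.of_forall fun X => sq_nonneg _)]
    refine ENNReal.ofReal_le_ofReal ?_
    simp only [div_pow]
    rw [integral_div]
    rcases Nat.eq_zero_or_pos n with rfl | hn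
    · simp
    · have hn' : (0 : ℝ) < n := by exact_mod_cast hn
      rw [div_le_iff₀ (by positivity)]
      refine (integral_sq_compensatedSum_le x ω hB (n ^ 2)).trans (le_of_eq ?_)
      push_cast
      field_simp
  have hsum : Summable fun n : ℕ => (2 * B) ^ 2 * (1 / (n : ℝ) ^ 2) :=
    (Real.summable_one_div_nat_pow.2 one_lt_two).mul_left _
  have hlt : ∫⁻ X, ∑' n, f n X ∂(walkLaw x ω) ≠ ⊤ := by
    rw [lintegral_tsum fun n => (hfm n).aemeasurable]
    exact ((ENNReal.tsum_le_tsum hfi).trans_lt hsum.tsum_ofReal_lt_top).ne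
  filter_upwards [ae_lt_top (Measurable.tsum hfm) hlt] with X hX
  have h1 := ENNReal.tendsto_atTop_zero_of_tsum_ne_top hX.ne
  have h2 := (ENNReal.tendsto_toReal ENNReal.zero_ne_top).comp h1
  simp only [hf, Function.comp_def, ENNReal.toReal_ofReal (sq_nonneg _), ENNReal.toReal_zero] at h2
  have h3 := h2.sqrt
  simp only [Real.sqrt_sq_eq_abs, Real.sqrt_zero] at h3
  exact (tendsto_zero_iff_abs_tendsto_zero _).2 h3

lemma ae_tendsto_compensatedSum_div {d : ℕ} (x : Fin d → ℤ) (ω : Environment d)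
    {h : (Fin d → ℤ) → ℝ} {B : ℝ} (hB : ∀ x, |h x| ≤ B) :
    ∀ᵐ X ∂(walkLaw x ω), Tendsto (fun n : ℕ => compensatedSum ω h X n / (n : ℝ)) atTop (𝓝 0) := by
  filter_upwards [ae_tendsto_compensatedSum_sq_div x ω hB] with X hX
  -- Adding the linear drift `2 B n` makes the sequence monotone, so squares suffice.
  have hmono : Monotone fun n : ℕ => compensatedSum ω h X n + 2 * B * n := by
    refine monotone_nat_of_le_succ fun n => ?_
    have h1 : compensatedSum ω h X (n + 1) =
        compensatedSum ω h X n + (h (X (n + 1)) - stepMean ω h (X n)) :=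
      Finset.sum_range_succ _ _
    have := (abs_le.1 (abs_increment_le ω hB (X n) (X (n + 1)))).1
    push_cast
    linarith
  have hdiv : ∀ n : ℕ, 0 < n → (compensatedSum ω h X n + 2 * B * n) / n =
      compensatedSum ω h X n / n + 2 * B := fun n hn => by
    have : (n : ℝ) ≠ 0 := by positivity
    field_simp
  have hlim := tendsto_div_of_monotone_of_exists_subseq_tendsto_div _ (2 * B) hmono fun a ha => by
    refine ⟨fun n => n ^ 2, ?_, tendsto_pow_atTop two_ne_zero, ?_⟩
    · have : Tendsto (fun n : ℕ => (1 + 1 / (n : ℝ)) ^ 2) atTop (𝓝 1) := by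
        simpa using (tendsto_one_div_atTop_nhds_zero_nat (𝕜 := ℝ)).const_add 1 |>.pow 2
      filter_upwards [this.eventually (gt_mem_nhds ha), eventually_gt_atTop 0] with n h1 h2
      have hn : (0 : ℝ) < n := by exact_mod_cast h2
      have e : (((n + 1) ^ 2 : ℕ) : ℝ) = (1 + 1 / (n : ℝ)) ^ 2 * ((n ^ 2 : ℕ) : ℝ) := by
        push_cast
        field_simp
      rw [e]
      gcongr
    · have := hX.add_const (2 * B)
      rw [zero_add] at this
      refine this.congr' ?_
      filter_upwards [eventually_gt_atTop 0] with n hn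
      exact (hdiv (n ^ 2) (by positivity)).symm
  have := hlim.sub_const (2 * B)
  rw [sub_self] at this
  refine this.congr' ?_
  filter_upwards [eventually_gt_atTop 0] with n hn
  rw [hdiv n hn, add_sub_cancel_right]

/-! ### Occupation times -/

open Classical in
lemma visits_eq_sum {d : ℕ} (A : Set (Fin d → ℤ)) (X : ℕ → (Fin d → ℤ)) (N : ℕ) :
    (visits A X N : ℝ) = ∑ i ∈ Finset.range (N + 1), if X i ∈ A then (1 : ℝ) else 0 := by
  rw [visits, Finset.card_filter]
  push_cast
  rfl

open Classical in
/-- A bounded function whose expected increment dominates `1_A - θ` certifies that the walk spends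
at most a proportion `θ` of its time in `A`. -/
lemma ae_eventually_visits_div_le {d : ℕ} (x : Fin d → ℤ) (ω : Environment d)
    {h : (Fin d → ℤ) → ℝ} {B : ℝ} (hB : ∀ x, |h x| ≤ B) {A : Set (Fin d → ℤ)} {θ : ℝ}
    (hA : ∀ x, (if x ∈ A then (1 : ℝ) else 0) - θ ≤ stepMean ω h x - h x) {ε : ℝ} (hε : 0 < ε) :
    ∀ᵐ X ∂(walkLaw x ω), ∀ᶠ N : ℕ in atTop, (visits A X N : ℝ) / N ≤ θ + ε := by
  filter_upwards [ae_tendsto_compensatedSum_div x ω hB] with X hX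
  have hlim : Tendsto (fun N : ℕ => (1 + 2 * B) / (N : ℝ) - compensatedSum ω h X N / N)
      atTop (𝓝 0) := by
    simpa using (tendsto_const_div_atTop_nhds_zero_nat (1 + 2 * B)).sub hX
  filter_upwards [hlim.eventually (gt_mem_nhds hε), eventually_gt_atTop 0] with N h1 h2
  have hN : (0 : ℝ) < N := by exact_mod_cast h2
  have hv : (visits A X N : ℝ) ≤ N * θ + 1 + (h (X N) - h (X 0)) - compensatedSum ω h X N := by
    rw [visits_eq_sum, Finset.sum_range_succ]
    have hlast : (if X N ∈ A then (1 : ℝ) else 0) ≤ 1 := by split_ifs <;> norm_num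
    have hsum := Finset.sum_le_sum fun i (_ : i ∈ Finset.range N) => hA (X i)
    have htel := Finset.sum_range_sub (fun i => h (X i)) N
    rw [Finset.sum_sub_distrib] at hsum htel
    simp only [Finset.sum_sub_distrib, Finset.sum_const, Finset.card_range, nsmul_eq_mul] at hsum
    simp only [compensatedSum, Finset.sum_sub_distrib]
    linarith
  have h3 := (abs_le.1 (hB (X N))).2
  have h4 := (abs_le.1 (hB (X 0))).1
  rw [← sub_div, div_lt_iff₀ hN] at h1
  rw [div_le_iff₀ hN]
  linarith

/-! ### Integer heights -/

/-- The integer inner product `⟨x, U⟩`. -/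
def intHeight {d : ℕ} (U x : Fin d → ℤ) : ℤ := ∑ i, x i * U i

lemma intHeight_add {d : ℕ} (U x y : Fin d → ℤ) :
    intHeight U (x + y) = intHeight U x + intHeight U y := by
  simp [intHeight, add_mul, Finset.sum_add_distrib]

lemma abs_intHeight_unitVec_le {d : ℕ} (U : Fin d → ℤ) (e : UnitVec d) :
    |intHeight U e.1| ≤ ((∑ i, (U i).natAbs : ℕ) : ℤ) := by
  push_cast
  refine (Finset.abs_sum_le_sum_abs _ _).trans (Finset.sum_le_sum fun i _ => ?_)
  have hi : |e.1 i| ≤ 1 :=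
    (Finset.single_le_sum (f := fun i => |e.1 i|) (fun k _ => abs_nonneg _)
      (Finset.mem_univ i)).trans e.2.le
  rw [abs_mul]
  exact mul_le_of_le_one_left (abs_nonneg _) hi

lemma intHeight_emod {d : ℕ} (U x : Fin d → ℤ) (N : ℤ) :
    intHeight U (fun i => x i % N) % N = intHeight U x % N := by
  refine Int.ModEq.sum (fun i _ => ?_)
  exact (Int.mod_modEq (x i) N).mul_right _

lemma exists_common_denominator {d : ℕ} (u : Fin d → ℚ) :
    ∃ (U : Fin d → ℤ) (q : ℕ), 0 < q ∧ ∀ i, u i * q = U i := by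
  refine ⟨fun i => (u i).num * ∏ k ∈ Finset.univ.erase i, ((u k).den : ℤ), ∏ k, (u k).den,
    Finset.prod_pos fun k _ => (u k).pos, fun i => ?_⟩
  rw [← Finset.mul_prod_erase Finset.univ _ (Finset.mem_univ i)]
  push_cast
  rw [← mul_assoc, Rat.mul_den_eq_num]

lemma height_mul_eq_intHeight {d : ℕ} {u : Fin d → ℚ} {U : Fin d → ℤ} {q : ℕ}
    (hU : ∀ i, u i * q = U i) (x : Fin d → ℤ) : height u x * q = intHeight U x := by
  simp only [height, intHeight, Finset.sum_mul]
  push_cast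
  exact Finset.sum_congr rfl fun i _ => by rw [← hU i]; ring

/-- The second moment of the integer height of one step with law `p`; it is the variance when the
step is centred in the direction `U`. -/
noncomputable def stepVariance {d : ℕ} (U : Fin d → ℤ) (p : JumpLaw d) : ℝ :=
  ∑ e : UnitVec d, p.1 e * (intHeight U e.1 : ℝ) ^ 2

lemma stepVariance_le {d : ℕ} (U : Fin d → ℤ) (p : JumpLaw d) :
    stepVariance U p ≤ ((∑ i, (U i).natAbs : ℕ) : ℝ) ^ 2 := by
  calc stepVariance U p ≤ ∑ e : UnitVec d, p.1 e * ((∑ i, (U i).natAbs : ℕ) : ℝ) ^ 2 := by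
        refine Finset.sum_le_sum fun e _ => mul_le_mul_of_nonneg_left ?_ (p.2.1 e)
        rw [← sq_abs]
        refine pow_le_pow_left₀ (abs_nonneg _) ?_ 2
        have he : ((|intHeight U e.1| : ℤ) : ℝ) ≤ (((∑ i, (U i).natAbs : ℕ) : ℤ) : ℝ) :=
          Int.cast_le.2 (abs_intHeight_unitVec_le U e)
        rwa [Int.cast_abs, Int.cast_natCast] at he
    _ = _ := by rw [← Finset.sum_mul, p.2.2, one_mul]

lemma le_stepVariance {d : ℕ} {U : Fin d → ℤ} {i : Fin d} (hi : U i ≠ 0) {κ : ℝ} (hκ : 0 < κ)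
    {p : JumpLaw d} (hp : p ∈ ellipticLaws d κ) : κ ≤ stepVariance U p := by
  let e : UnitVec d := ⟨Pi.single i 1, by
    rw [Finset.sum_eq_single i] <;> simp +contextual⟩
  have he : intHeight U e.1 = U i := by
    simp [intHeight, e, Pi.single_apply]
  have h1 : (1 : ℝ) ≤ (U i : ℝ) ^ 2 := by
    have : (1 : ℤ) ≤ U i ^ 2 := Order.one_le_iff_pos.2 (sq_pos_iff.2 hi)
    exact_mod_cast this
  calc κ ≤ p.1 e * (intHeight U e.1 : ℝ) ^ 2 := by
        rw [he]
        have := hp e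
        nlinarith
    _ ≤ stepVariance U p :=
        Finset.single_le_sum (f := fun e : UnitVec d => p.1 e * (intHeight U e.1 : ℝ) ^ 2)
          (fun e _ => mul_nonneg (p.2.1 e) (sq_nonneg _)) (Finset.mem_univ e)

lemma sum_mul_intHeight_eq_zero {d : ℕ} {u : Fin d → ℚ} {U : Fin d → ℤ} {q : ℕ}
    (hU : ∀ i, u i * q = U i) {p : JumpLaw d} (hp : ∑ i, drift p i * (u i : ℝ) = 0) :
    ∑ e : UnitVec d, p.1 e * (intHeight U e.1 : ℝ) = 0 := by
  have hU' : ∀ i, (u i : ℝ) * q = U i := fun i => by exact_mod_cast hU i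
  have : ∑ e : UnitVec d, p.1 e * (intHeight U e.1 : ℝ) = (∑ i, drift p i * (u i : ℝ)) * q := by
    simp only [intHeight, drift, Finset.sum_mul]
    push_cast
    simp only [Finset.mul_sum]
    rw [Finset.sum_comm]
    exact Finset.sum_congr rfl fun i _ => Finset.sum_congr rfl fun e _ => by rw [← hU' i]; ring
  rw [this, hp, zero_mul]

/-- A centred step increases a function lying above a parabola by at least its second-order term. -/
lemma mul_stepVariance_le {d : ℕ} {ω : Environment d} {U : Fin d → ℤ} {G : ℤ → ℝ}
    {x : Fin d → ℤ} {D c : ℝ}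
    (h0 : ∑ e : UnitVec d, (ω x).1 e * (intHeight U e.1 : ℝ) = 0)
    (hG : ∀ s : ℤ, |s| ≤ ((∑ i, (U i).natAbs : ℕ) : ℤ) →
      s * D + (s : ℝ) ^ 2 * c ≤ G (intHeight U x + s) - G (intHeight U x)) :
    c * stepVariance U (ω x) ≤
      stepMean ω (fun y => G (intHeight U y)) x - G (intHeight U x) := by
  calc c * stepVariance U (ω x)
      = ∑ e : UnitVec d, (ω x).1 e *
          ((intHeight U e.1 : ℝ) * D + (intHeight U e.1 : ℝ) ^ 2 * c) := by
        simp only [mul_add, Finset.sum_add_distrib, ← mul_assoc, ← Finset.sum_mul, h0]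
        rw [stepVariance]; ring
    _ ≤ ∑ e : UnitVec d, (ω x).1 e *
          (G (intHeight U x + intHeight U e.1) - G (intHeight U x)) :=
        Finset.sum_le_sum fun e _ => mul_le_mul_of_nonneg_left
          (hG _ (abs_intHeight_unitVec_le U e)) ((ω x).2.1 e)
    _ = _ := by
        simp only [mul_sub, Finset.sum_sub_distrib, ← Finset.sum_mul, (ω x).2.2, one_mul, stepMean,
          intHeight_add]

/-! ### Strip environments of integer width -/

/-- The environment that uses `σ l` at the sites whose integer height, modulo the total width of
`j` strips, lies in the strip number `l`. -/
def stripEnv {d : ℕ} (U : Fin d → ℤ) (w : ℕ → ℕ) (j : ℕ) (σ : ℕ → JumpLaw d) : Environment d :=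
  fun x => σ (stripIndex w (intHeight U x % stripStart w j).toNat)

lemma periodicEnv_stripEnv {d : ℕ} (U : Fin d → ℤ) (w : ℕ → ℕ) (j : ℕ) (σ : ℕ → JumpLaw d)
    (hN : 0 < stripStart w j) :
    periodicEnv (fun _ : Fin d => (⟨stripStart w j, hN⟩ : ℕ+)) (fun y => stripEnv U w j σ y.1) =
      stripEnv U w j σ := by
  funext x
  simp only [periodicEnv, stripEnv, modBox, PNat.mk_coe]
  rw [intHeight_emod]

lemma toNat_emod_stripStart_lt (w : ℕ → ℕ) {j : ℕ} (hN : 0 < stripStart w j) (z : ℤ) :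
    (z % stripStart w j).toNat < stripStart w j := by
  have := Int.emod_lt_of_pos z (show (0 : ℤ) < stripStart w j by omega)
  omega

lemma isStripPeriodicEnv_stripEnv {d j : ℕ} {u : Fin d → ℚ} {U : Fin d → ℤ} {q : ℕ} (hq : 0 < q)
    (hU : ∀ i, u i * q = U i) {w : ℕ → ℕ} (hw : ∀ i, 0 < w i) (σ : Fin j → JumpLaw d)
    (σ' : ℕ → JumpLaw d) (hσ' : ∀ l : Fin j, σ' l = σ l) :
    IsStripPeriodicEnv u (fun k : Fin (j + 1) => (stripStart w k : ℝ) / q) σ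
      (stripEnv U w j σ') := by
  have hq' : (0 : ℝ) < q := by exact_mod_cast hq
  refine ⟨by simp [stripStart], fun a b hab => ?_, fun k l x hx => ?_⟩
  · exact div_lt_div_of_pos_right (by exact_mod_cast stripStart_strictMono hw hab) hq'
  · have hz : (height u x : ℝ) = (intHeight U x : ℝ) / q := by
      rw [eq_div_iff hq'.ne']
      exact_mod_cast height_mul_eq_intHeight hU x
    simp only [strip, Set.mem_ofPred_eq, hz, Fin.val_last, Fin.val_castSucc, Fin.val_succ] at hx
    rw [← mul_div_assoc, ← add_div, ← add_div, div_le_div_iff_of_pos_right hq',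
      div_lt_div_iff_of_pos_right hq'] at hx
    obtain ⟨h1, h2⟩ := hx
    have h1' : k * stripStart w j + stripStart w l ≤ intHeight U x := by exact_mod_cast h1
    have h2' : intHeight U x < k * stripStart w j + stripStart w (l + 1) := by exact_mod_cast h2
    have h3 : (stripStart w (l + 1) : ℤ) ≤ stripStart w j := by
      exact_mod_cast (stripStart_strictMono hw).monotone (show (l : ℕ) + 1 ≤ j from l.2)
    have h4 : intHeight U x % stripStart w j = intHeight U x - k * stripStart w j := by
      rw [← Int.sub_mul_emod_self_right (intHeight U x) k]
      exact Int.emod_eq_of_lt (by omega) (by omega)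
    rw [stripEnv, h4, stripIndex_eq hw (k := l) (by omega) (by omega), hσ']

/-! ### From upper bounds to two-sided bounds -/

lemma abs_sub_le_of_forall_le_add {ι : Type*} [Fintype ι] {a b : ι → ℝ} {η : ℝ}
    (hη : 0 ≤ η) (hab : ∀ m, a m ≤ b m + η) (hsum : ∑ m, b m ≤ ∑ m, a m) (m : ι) :
    |a m - b m| ≤ Fintype.card ι * η := by
  have h1 : ∑ l, (b l + η - a l) ≤ Fintype.card ι * η := by
    simp only [Finset.sum_sub_distrib, Finset.sum_add_distrib, Finset.sum_const, Finset.card_univ,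
      nsmul_eq_mul]
    linarith
  have h2 := Finset.single_le_sum (f := fun l => b l + η - a l)
    (fun l _ => by linarith [hab l]) (Finset.mem_univ m)
  have h3 : η ≤ Fintype.card ι * η := by
    have : (1 : ℝ) ≤ Fintype.card ι := by exact_mod_cast Fintype.card_pos_iff.2 ⟨m⟩
    nlinarith
  rw [abs_le]
  constructor <;> linarith [hab m]

lemma le_sum_visits {d : ℕ} {ι : Type*} [Fintype ι] {A : ι → Set (Fin d → ℤ)}
    (hA : ∀ x, ∃ m, x ∈ A m) (X : ℕ → (Fin d → ℤ)) (N : ℕ) :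
    (N : ℝ) ≤ ∑ m, (visits (A m) X N : ℝ) := by
  classical
  simp only [visits_eq_sum]
  rw [Finset.sum_comm]
  have h1 : ∀ i, (1 : ℝ) ≤ ∑ m, if X i ∈ A m then (1 : ℝ) else 0 := fun i => by
    obtain ⟨m, hm⟩ := hA (X i)
    refine le_trans (by simp [hm]) (Finset.single_le_sum
      (f := fun m => if X i ∈ A m then (1 : ℝ) else 0)
      (fun m _ => by split_ifs <;> norm_num) (Finset.mem_univ m))
  have := Finset.card_nsmul_le_sum (Finset.range (N + 1)) _ (1 : ℝ) fun i _ => h1 i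
  simp only [Finset.card_range, nsmul_eq_mul, mul_one] at this
  push_cast at this
  linarith

end StripWalk

/-! ### Construction of the strip environment -/

theorem lemmal32 (d j : ℕ) (hj : 1 ≤ j) (κ : ℝ) (hκ : 0 < κ)
    (σ : Fin j → StripWalk.JumpLaw d) (hσ : ∀ i, σ i ∈ StripWalk.ellipticLaws d κ)
    (hσ_inj : Function.Injective σ)
    (u : Fin d → ℚ) (hu : ∑ i, u i ^ 2 = 1)
    (hdrift : ∀ m, ∑ i, StripWalk.drift (σ m) i * (u i : ℝ) = 0)
    (ε : ℝ) (hε : 0 < ε) (lam : Fin j → ℝ) (hlam : lam ∈ stdSimplex ℝ (Fin j)) :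
    ∃ (n : Fin d → ℕ+) (p : StripWalk.box n → StripWalk.JumpLaw d),
      (∀ x, p x ∈ Set.range σ) ∧
      (∃ r : Fin (j + 1) → ℝ,
        StripWalk.IsStripPeriodicEnv u r σ (StripWalk.periodicEnv n p)) ∧
      ∀ᵐ X ∂(StripWalk.walkLaw 0 (StripWalk.periodicEnv n p)), ∀ m : Fin j,
        Filter.limsup (fun N : ℕ =>
          |(StripWalk.visits {x | StripWalk.periodicEnv n p x = σ m} X N : ℝ) / (N : ℝ)
            - lam m|) Filter.atTop ≤ ε := by
  classical
  obtain ⟨U, q, hq, hU⟩ := StripWalk.exists_common_denominator u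
  obtain ⟨i₀, hi₀⟩ : ∃ i, U i ≠ 0 := by
    by_contra! h
    have hu0 : ∀ i, u i = 0 := fun i => by
      have := hU i
      rw [h i, Int.cast_zero, mul_eq_zero] at this
      exact this.resolve_right (by exact_mod_cast hq.ne')
    simp [hu0] at hu
  -- The laws and weights are indexed by `ℕ`, with irrelevant values from `j` on.
  set σ' : ℕ → StripWalk.JumpLaw d := fun i => if h : i < j then σ ⟨i, h⟩ else σ ⟨0, hj⟩ with hσ'
  have hσ'l : ∀ l : Fin j, σ' l = σ l := fun l => by simp [hσ']
  have hrange : ∀ i, ∃ l, σ' i = σ l := fun i => by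
    by_cases h : i < j
    · exact ⟨⟨i, h⟩, by simp [hσ', h]⟩
    · exact ⟨⟨0, hj⟩, by simp [hσ', h]⟩
  set lam' : ℕ → ℝ := fun i => if h : i < j then lam ⟨i, h⟩ else 0 with hlam'
  have hlam'l : ∀ l : Fin j, lam' l = lam l := fun l => by simp [hlam']
  have hj0 : (0 : ℝ) < j := by exact_mod_cast hj
  -- `η` is lost once in the corrector and once in the convergence, for each of the `j` strips.
  set η : ℝ := ε / (2 * j) with hη
  have hη0 : 0 < η := by positivity
  obtain ⟨w, hw, hG⟩ := StripWalk.exists_widths hj (∑ i, (U i).natAbs)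
    (V := fun i => StripWalk.stepVariance U (σ' i)) (lam := lam') hκ
    (fun i => by
      obtain ⟨l, hl⟩ := hrange i
      simp only [hl]
      exact StripWalk.le_stepVariance hi₀ hκ (hσ l))
    (fun i => StripWalk.stepVariance_le U _)
    (fun i => by
      simp only [hlam']
      split_ifs
      · exact hlam.1 _
      · exact le_rfl)
    (by rw [Finset.sum_range]; simp only [hlam'l]; exact hlam.2) hη0
  have hN : 0 < StripWalk.stripStart w j := by
    have := (StripWalk.stripStart_strictMono hw).le_apply (x := j)
    omega
  refine ⟨fun _ => ⟨StripWalk.stripStart w j, hN⟩, fun y => StripWalk.stripEnv U w j σ' y.1,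
    fun y => ?_, ?_⟩
  · obtain ⟨l, hl⟩ := hrange
      (StripWalk.stripIndex w (StripWalk.intHeight U y.1 % StripWalk.stripStart w j).toNat)
    exact ⟨l, hl.symm⟩
  rw [StripWalk.periodicEnv_stripEnv]
  set ω := StripWalk.stripEnv U w j σ' with hω
  have hmem : ∀ (x : Fin d → ℤ) (m : Fin j), ω x = σ m ↔
      StripWalk.stripIndex w (StripWalk.intHeight U x % StripWalk.stripStart w j).toNat = m := by
    intro x m
    have hlt := StripWalk.stripIndex_lt hw
      (StripWalk.toNat_emod_stripStart_lt w hN (StripWalk.intHeight U x))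
    have := hσ'l ⟨_, hlt⟩
    simp only at this
    rw [hω, StripWalk.stripEnv, this, hσ_inj.eq_iff, Fin.ext_iff]
  refine ⟨⟨_, StripWalk.isStripPeriodicEnv_stripEnv hq hU hw σ σ' hσ'l⟩, ?_⟩
  have hupper : ∀ m : Fin j, ∀ᵐ X ∂(StripWalk.walkLaw 0 ω), ∀ᶠ N : ℕ in Filter.atTop,
      (StripWalk.visits {x | ω x = σ m} X N : ℝ) / N ≤ lam m + η + η := by
    intro m
    obtain ⟨G, hGp, hGs⟩ := hG m m.2
    obtain ⟨B, hB⟩ := StripWalk.exists_bound_of_periodic hN hGp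
    refine StripWalk.ae_eventually_visits_div_le 0 ω
      (h := fun x => G (StripWalk.intHeight U x)) (fun x => hB _) (fun x => ?_) hη0
    obtain ⟨D, c, h1, h2⟩ := hGs (StripWalk.intHeight U x)
    have h0 : ∑ e : StripWalk.UnitVec d,
        (ω x).1 e * (StripWalk.intHeight U e.1 : ℝ) = 0 := by
      obtain ⟨l, hl⟩ := hrange
        (StripWalk.stripIndex w (StripWalk.intHeight U x % StripWalk.stripStart w j).toNat)
      have : ω x = σ l := hl
      rw [this]
      exact StripWalk.sum_mul_intHeight_eq_zero hU (hdrift l)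
    have h3 := StripWalk.mul_stepVariance_le h0 h1
    simp only [Set.mem_ofPred_eq, hmem, hlam'l] at h2 ⊢
    have h4 : StripWalk.stepVariance U (ω x) = StripWalk.stepVariance U (σ'
      (StripWalk.stripIndex w (StripWalk.intHeight U x % StripWalk.stripStart w j).toNat)) := rfl
    rw [h4] at h3
    linarith
  filter_upwards [MeasureTheory.ae_all_iff.2 hupper] with X hX m
  refine Filter.limsup_le_of_le
    (Filter.isBoundedUnder_of ⟨0, fun N => abs_nonneg _⟩).isCoboundedUnder_le ?_
  filter_upwards [Filter.eventually_all.2 hX, Filter.eventually_gt_atTop 0] with N h1 h2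
  have hN' : (0 : ℝ) < N := by exact_mod_cast h2
  have h3 := StripWalk.le_sum_visits (A := fun m : Fin j => {x | ω x = σ m}) (fun x => by
    obtain ⟨l, hl⟩ := hrange
      (StripWalk.stripIndex w (StripWalk.intHeight U x % StripWalk.stripStart w j).toNat)
    exact ⟨l, hl⟩) X N
  have h4 := StripWalk.abs_sub_le_of_forall_le_add (η := 2 * η)
    (a := fun m : Fin j => (StripWalk.visits {x | ω x = σ m} X N : ℝ) / N) (b := lam)
    (by positivity) (fun l => by linarith [h1 l]) (by
      rw [hlam.2, ← Finset.sum_div, le_div_iff₀ hN', one_mul]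
      exact h3) m
  refine h4.trans (le_of_eq ?_)
  rw [Fintype.card_fin, hη]
  field_simp
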